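/- A hook of a partition $\lambda$ with corner a box $c$ of its Young diagram consists of $c$, the boxes to the right of $c$ in the same row and the boxes below $c$ in the same column; its length is its number of boxes. For positive integers $t_1,\dots,t_m$, a $(t_1,\dots,t_m)$-core is a partition whose Young diagram has no hook of length $t_1,\dots,t_m$, and $|\lambda|$ denotes the size of $\lambda$. Let $s=2k>2$ be an even integer. Then there is a unique $(s-1,s+1)$-core of maximal size, denoted $\kappa_{s\pm1}$, and there is a (not necessarily unique) $(s-1,s,s+1)$-core of maximal size. If $\kappa_{s-1,s,s+1}$ denotes any of the latter, then $$|\kappa_{s\pm1}|>|\kappa_{s-1,s,s+1}|,\qquad\text{and more precisely}\qquad |\kappa_{s\pm1}|=4\,|\kappa_{s-1,s,s+1}|.$$ -/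

import Mathlib

/-!
Partitions are represented by their Young diagrams (Mathlib's `YoungDiagram`); the box `(i, j)`
lies in row `i` and column `j`, and the size `|μ|` of a partition is `μ.card`, the number of boxes.
-/

namespace YoungDiagram

/-- The hook of `μ` with corner `c`: the boxes to the right of `c` in the same row, the boxes
below `c` in the same column, and `c` itself. -/
def hook (μ : YoungDiagram) (c : ℕ × ℕ) : Finset (ℕ × ℕ) :=
  μ.cells.filter fun d => (d.1 = c.1 ∧ c.2 ≤ d.2) ∨ (d.2 = c.2 ∧ c.1 ≤ d.1)

/-- The length of a hook is its number of boxes. -/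
def hookLength (μ : YoungDiagram) (c : ℕ × ℕ) : ℕ :=
  (μ.hook c).card

/-- `μ` is a `t`-core if no hook of length `t` appears in its Young diagram. -/
def IsCore (μ : YoungDiagram) (t : ℕ) : Prop :=
  ∀ c ∈ μ, μ.hookLength c ≠ t

/-- `μ` is a simultaneous core for all hook lengths in `T`. -/
def IsSimultaneousCore (μ : YoungDiagram) (T : Set ℕ) : Prop :=
  ∀ t ∈ T, μ.IsCore t

/-- `μ` is a simultaneous `T`-core of maximal size. -/
def IsLargestSimultaneousCore (μ : YoungDiagram) (T : Set ℕ) : Prop :=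
  μ.IsSimultaneousCore T ∧ ∀ ν : YoungDiagram, ν.IsSimultaneousCore T → ν.card ≤ μ.card

end YoungDiagram

/-! A partition is encoded by its beta set X, the hook lengths of its first column. Hooks correspond
to pairs of an element of X and a smaller gap, the length being their difference, so μ is a t-core
iff X is closed under subtracting t (`isCore_iff_betaSet`). Fix a = s - 1. For an a-core, X is
determined by the least gap v z in each class z mod a, |μ| is an affine function of the variance of
v (`IsApery.card_eq`), and being a t-core means v (z + t) ≤ v z + t.

With b = s + 1 and u i = v (i b), an (a, b)-core has u (i + 1) ≤ u i + b on a cycle of length a. The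
variance is a sum of squared differences, grouped here by lag l. A difference at lag l lies between
-(a - l) b and l b, and the differences at one lag sum to 0; this bounds the variance, and equality
forces u n = n b for n < a. Hence the maximum (a² - 1)(b² - 1)/24, attained by a unique core.

Let s = 2m + 2. As s ≡ (m + 1) b mod a, the s-core condition is a further bound at lag m + 1.
Writing a difference at lag l ≤ m as l b - a x makes x an integer in [0, m + 2], and a Katona-style
argument (`card_le_of_intersecting_arcs`) shows that x = m + 2 occurs at most l times. This sharpens
the bound to |μ| ≤ m (m + 1)² (m + 2)/6, which is attained and is a quarter of the former maximum.
-/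

namespace YoungDiagram

/-! ### Beta sets and hooks -/

/-- The hook length of the first box of row `i` (for `i` a nonempty row). -/
def bead (μ : YoungDiagram) (i : ℕ) : ℕ :=
  μ.rowLen i + (μ.colLen 0 - 1 - i)

/-- The set of first-column hook lengths of `μ`. -/
def betaSet (μ : YoungDiagram) : Finset ℕ :=
  (Finset.range (μ.colLen 0)).image μ.bead

theorem mem_betaSet {μ : YoungDiagram} {x : ℕ} :
    x ∈ μ.betaSet ↔ ∃ i < μ.colLen 0, μ.bead i = x := by
  simp [betaSet]

theorem rowLen_pos_iff {μ : YoungDiagram} {i : ℕ} : 0 < μ.rowLen i ↔ i < μ.colLen 0 := by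
  rw [← mem_iff_lt_rowLen, mem_iff_lt_colLen]

theorem lt_rowLen_iff_lt_colLen {μ : YoungDiagram} {i j : ℕ} :
    j < μ.rowLen i ↔ i < μ.colLen j := by
  rw [← mem_iff_lt_rowLen, mem_iff_lt_colLen]

theorem bead_lt_bead {μ : YoungDiagram} {i j : ℕ} (hij : i < j) (hj : j < μ.colLen 0) :
    μ.bead j < μ.bead i := by
  have := μ.rowLen_anti i j hij.le
  unfold bead
  omega

theorem bead_injOn (μ : YoungDiagram) : Set.InjOn μ.bead (Finset.range (μ.colLen 0)) := by
  intro i hi j hj h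
  simp only [Finset.coe_range, Set.mem_Iio] at hi hj
  rcases lt_trichotomy i j with hij | hij | hij
  · exact absurd h (bead_lt_bead hij hj).ne'
  · exact hij
  · exact absurd h (bead_lt_bead hij hi).ne

theorem card_betaSet (μ : YoungDiagram) : μ.betaSet.card = μ.colLen 0 := by
  rw [betaSet, Finset.card_image_of_injOn μ.bead_injOn, Finset.card_range]

theorem zero_notMem_betaSet (μ : YoungDiagram) : 0 ∉ μ.betaSet := by
  rw [mem_betaSet]
  rintro ⟨i, hi, h⟩
  have := rowLen_pos_iff.2 hi
  unfold bead at h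
  omega

theorem hookLength_eq {μ : YoungDiagram} {i j : ℕ} (h : (i, j) ∈ μ) :
    μ.hookLength (i, j) + i + j + 1 = μ.rowLen i + μ.colLen j := by
  have hr := mem_iff_lt_rowLen.1 h
  have hc := mem_iff_lt_colLen.1 h
  have key : μ.hook (i, j) = ({i} ×ˢ Finset.Ico j (μ.rowLen i)) ∪
      (Finset.Ico (i + 1) (μ.colLen j) ×ˢ {j}) := by
    ext ⟨p, q⟩
    simp only [hook, Finset.mem_filter, mem_cells, Finset.mem_union, Finset.mem_product,
      Finset.mem_singleton, Finset.mem_Ico]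
    constructor
    · rintro ⟨hm, ⟨rfl, hq⟩ | ⟨rfl, hp⟩⟩
      · exact Or.inl ⟨rfl, hq, mem_iff_lt_rowLen.1 hm⟩
      · rcases hp.eq_or_lt with rfl | hp
        · exact Or.inl ⟨rfl, le_rfl, hr⟩
        · exact Or.inr ⟨⟨hp, mem_iff_lt_colLen.1 hm⟩, rfl⟩
    · rintro (⟨rfl, hq, hq'⟩ | ⟨⟨hp, hp'⟩, rfl⟩)
      · exact ⟨mem_iff_lt_rowLen.2 hq', Or.inl ⟨rfl, hq⟩⟩
      · exact ⟨mem_iff_lt_colLen.2 hp', Or.inr ⟨rfl, by omega⟩⟩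
  have hdisj : Disjoint ({i} ×ˢ Finset.Ico j (μ.rowLen i))
      (Finset.Ico (i + 1) (μ.colLen j) ×ˢ {j}) := by
    rw [Finset.disjoint_left]
    rintro ⟨p, q⟩ h1 h2
    simp only [Finset.mem_product, Finset.mem_singleton, Finset.mem_Ico] at h1 h2
    omega
  rw [hookLength, key, Finset.card_union_of_disjoint hdisj]
  simp only [Finset.card_product, Finset.card_singleton, Nat.card_Ico, one_mul, mul_one]
  omega

/-- The missing bead attached to column `j`. -/
def coBead (μ : YoungDiagram) (j : ℕ) : ℕ :=
  j + (μ.colLen 0 - μ.colLen j)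

theorem coBead_lt_bead_iff {μ : YoungDiagram} {i j : ℕ} (hi : i < μ.colLen 0) :
    μ.coBead j < μ.bead i ↔ (i, j) ∈ μ := by
  have h1 := μ.colLen_anti 0 j (Nat.zero_le _)
  have h2 : j < μ.rowLen i ↔ i < μ.colLen j := lt_rowLen_iff_lt_colLen
  rw [mem_iff_lt_rowLen]
  unfold coBead bead
  by_cases h : i < μ.colLen j
  · have := h2.2 h
    omega
  · have := mt h2.1 h
    omega

theorem coBead_ne_bead {μ : YoungDiagram} {i j : ℕ} (hi : i < μ.colLen 0) :
    μ.coBead j ≠ μ.bead i := by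
  have h1 := μ.colLen_anti 0 j (Nat.zero_le _)
  have h2 : j < μ.rowLen i ↔ i < μ.colLen j := lt_rowLen_iff_lt_colLen
  unfold coBead bead
  by_cases h : i < μ.colLen j
  · have := h2.2 h
    omega
  · have := mt h2.1 h
    omega

theorem coBead_notMem_betaSet (μ : YoungDiagram) (j : ℕ) : μ.coBead j ∉ μ.betaSet := by
  rw [mem_betaSet]
  rintro ⟨i, hi, h⟩
  exact coBead_ne_bead hi h.symm

/-- The column of a gap `y` is the number of gaps below it: if m of the L beads lie above `y`, that
is y - (L - m). -/
theorem exists_coBead_eq {μ : YoungDiagram} {y : ℕ} (hy : y ∉ μ.betaSet) :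
    ∃ j, μ.coBead j = y := by
  classical
  have hex : ∃ m, m = μ.colLen 0 ∨ μ.bead m < y := ⟨_, Or.inl rfl⟩
  obtain ⟨m, hm, hmin⟩ : ∃ m, (m = μ.colLen 0 ∨ μ.bead m < y) ∧
      ∀ i < m, ¬ (i = μ.colLen 0 ∨ μ.bead i < y) :=
    ⟨Nat.find hex, Nat.find_spec hex, fun i hi => Nat.find_min hex hi⟩
  have hmL : m ≤ μ.colLen 0 := by
    by_contra hlt
    exact hmin _ (not_le.1 hlt) (Or.inl rfl)
  have hgt : ∀ i < m, y < μ.bead i := by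
    intro i hi
    have h1 := hmin i hi
    push Not at h1
    refine lt_of_le_of_ne h1.2 fun h => hy ?_
    exact mem_betaSet.2 ⟨i, by omega, h.symm⟩
  have hle : μ.colLen 0 ≤ y + m := by
    rcases hm with rfl | hm
    · omega
    · unfold bead at hm
      omega
  have hcol : μ.colLen (y + m - μ.colLen 0) = m := by
    apply le_antisymm
    · by_contra hlt
      have h1 := lt_rowLen_iff_lt_colLen.2 (not_le.1 hlt)
      have h2 := rowLen_pos_iff.1 (Nat.zero_lt_of_lt h1)
      rcases hm with rfl | hm
      · omega
      · unfold bead at hm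
        omega
    · rcases Nat.eq_zero_or_pos m with h0 | h0
      · omega
      · have h1 := hgt (m - 1) (by omega)
        have h2 : m - 1 < μ.colLen (y + m - μ.colLen 0) := by
          rw [← lt_rowLen_iff_lt_colLen]
          unfold bead at h1
          omega
        omega
  refine ⟨y + m - μ.colLen 0, ?_⟩
  unfold coBead
  omega

/-- With `coBead_lt_bead_iff` and `exists_coBead_eq`, this matches boxes with pairs of a bead and a
smaller gap. -/
theorem coBead_add_hookLength {μ : YoungDiagram} {i j : ℕ} (h : (i, j) ∈ μ) :
    μ.coBead j + μ.hookLength (i, j) = μ.bead i := by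
  have h1 := hookLength_eq h
  have h2 := μ.colLen_anti 0 j (Nat.zero_le _)
  have h3 := mem_iff_lt_colLen.1 h
  unfold coBead bead
  omega

theorem isCore_iff_betaSet {μ : YoungDiagram} {t : ℕ} (ht : 0 < t) :
    μ.IsCore t ↔ ∀ x ∈ μ.betaSet, t ≤ x → x - t ∈ μ.betaSet := by
  constructor
  · intro h x hx htx
    by_contra hy
    obtain ⟨i, hi, rfl⟩ := mem_betaSet.1 hx
    obtain ⟨j, hj⟩ := exists_coBead_eq hy
    have hmem : (i, j) ∈ μ := (coBead_lt_bead_iff hi).1 (by omega)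
    have := coBead_add_hookLength hmem
    exact h _ hmem (by omega)
  · rintro h ⟨i, j⟩ hc rfl
    have h1 := coBead_add_hookLength hc
    have hi : i < μ.colLen 0 := rowLen_pos_iff.1 (Nat.zero_lt_of_lt (mem_iff_lt_rowLen.1 hc))
    have h2 := h (μ.bead i) (mem_betaSet.2 ⟨i, hi, rfl⟩) (by omega)
    rw [← h1, Nat.add_sub_cancel] at h2
    exact coBead_notMem_betaSet μ j h2

/-! ### Size of a partition and its recovery from the beta set -/

theorem card_eq_sum_rowLen (μ : YoungDiagram) :
    μ.card = ∑ i ∈ Finset.range (μ.colLen 0), μ.rowLen i := by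
  have hmaps : Set.MapsTo Prod.fst (μ.cells : Set (ℕ × ℕ)) (Finset.range (μ.colLen 0)) := by
    rintro ⟨i, j⟩ hc
    have hc' : (i, j) ∈ μ := hc
    simpa using rowLen_pos_iff.1 (Nat.zero_lt_of_lt (mem_iff_lt_rowLen.1 hc'))
  rw [YoungDiagram.card, Finset.card_eq_sum_card_fiberwise hmaps]
  exact Finset.sum_congr rfl fun i _ => (rowLen_eq_card μ).symm

theorem card_add_choose_eq_sum_betaSet (μ : YoungDiagram) :
    μ.card + μ.betaSet.card.choose 2 = ∑ x ∈ μ.betaSet, x := by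
  rw [card_betaSet, betaSet, Finset.sum_image μ.bead_injOn, card_eq_sum_rowLen]
  simp only [bead]
  rw [Finset.sum_add_distrib, Finset.sum_range_reflect (fun i => i), Finset.sum_range_id,
    Nat.choose_two_right]

/-- Beads strictly decrease with the row, so sorting the beta set recovers them. -/
theorem bead_eq_orderEmbOfFin {μ : YoungDiagram} {X : Finset ℕ} (hX : μ.betaSet = X) {i : ℕ}
    (hi : i < X.card) :
    μ.bead i = X.orderEmbOfFin rfl ⟨X.card - 1 - i, by omega⟩ := by
  subst hX
  have hL := μ.card_betaSet
  have h := Finset.orderEmbOfFin_unique (s := μ.betaSet) rfl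
    (f := fun n : Fin μ.betaSet.card => μ.bead (μ.betaSet.card - 1 - n))
    (fun n => mem_betaSet.2 ⟨_, by omega, rfl⟩)
    (fun m n hmn => bead_lt_bead (by have : (m : ℕ) < n := hmn; omega) (by omega))
  rw [← congrFun h ⟨μ.betaSet.card - 1 - i, by omega⟩]
  congr 1
  simp only
  omega

theorem betaSet_injective : Function.Injective betaSet := by
  intro μ ν h
  have hL : μ.colLen 0 = ν.colLen 0 := by rw [← card_betaSet, h, card_betaSet]
  have hrow : ∀ i, μ.rowLen i = ν.rowLen i := by
    intro i
    by_cases hi : i < μ.colLen 0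
    · have hi' : i < ν.betaSet.card := by rwa [card_betaSet, ← hL]
      have h3 : μ.bead i = ν.bead i :=
        (bead_eq_orderEmbOfFin h hi').trans (bead_eq_orderEmbOfFin rfl hi').symm
      unfold bead at h3
      omega
    · have h1 := mt rowLen_pos_iff.1 hi
      have h2 := mt (rowLen_pos_iff (μ := ν)).1 (hL ▸ hi)
      omega
  ext ⟨i, j⟩
  rw [mem_cells, mem_cells, mem_iff_lt_rowLen, mem_iff_lt_rowLen, hrow]

theorem exists_rowLen_eq {f : ℕ → ℕ} (hf : Antitone f) {L : ℕ} (hL : f L = 0) :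
    ∃ μ : YoungDiagram, ∀ i, μ.rowLen i = f i := by
  have hmem : ∀ i j, (i, j) ∈ (Finset.range L ×ˢ Finset.range (f 0)).filter
      (fun c : ℕ × ℕ => c.2 < f c.1) ↔ j < f i := by
    intro i j
    simp only [Finset.mem_filter, Finset.mem_product, Finset.mem_range, and_iff_right_iff_imp]
    intro h
    refine ⟨?_, h.trans_le (hf (Nat.zero_le i))⟩
    by_contra hi
    have := hf (not_lt.1 hi)
    omega
  let μ : YoungDiagram :=
    { cells := (Finset.range L ×ˢ Finset.range (f 0)).filter (fun c : ℕ × ℕ => c.2 < f c.1)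
      isLowerSet := by
        rintro ⟨i, j⟩ ⟨i', j'⟩ ⟨hi, hj⟩ hc
        rw [Finset.mem_coe, hmem] at hc ⊢
        exact (hj.trans_lt hc).trans_le (hf hi) }
  refine ⟨μ, fun i => ?_⟩
  have h : ∀ j, j < μ.rowLen i ↔ j < f i := fun j => by
    rw [← mem_iff_lt_rowLen]
    exact hmem i j
  exact le_antisymm (le_of_not_gt fun hlt => lt_irrefl _ ((h _).1 hlt))
    (le_of_not_gt fun hlt => lt_irrefl _ ((h _).2 hlt))

theorem exists_betaSet_eq {X : Finset ℕ} (h0 : 0 ∉ X) : ∃ μ : YoungDiagram, μ.betaSet = X := by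
  let e : Fin X.card → ℕ := fun n => X.orderEmbOfFin rfl n
  have hmono : StrictMono e := (X.orderEmbOfFin rfl).strictMono
  -- As 0 is not in `X`, the element of index n exceeds n, so all `X.card` rows given by `f` below
  -- are nonempty.
  have hpos : ∀ n : ℕ, ∀ h : n < X.card, n < e ⟨n, h⟩ := by
    intro n
    induction n with
    | zero =>
      intro h
      have : e ⟨0, h⟩ ∈ X := X.orderEmbOfFin_mem rfl _
      exact Nat.pos_of_ne_zero fun h' => h0 (h' ▸ this)
    | succ n ih =>
      intro h
      have h1 := ih (by omega)
      have h2 : e ⟨n, by omega⟩ < e ⟨n + 1, h⟩ := hmono (by simp)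
      omega
  let f : ℕ → ℕ := fun i =>
    if h : i < X.card then e ⟨X.card - 1 - i, by omega⟩ - (X.card - 1 - i) else 0
  have hf : Antitone f := by
    refine antitone_nat_of_succ_le fun i => ?_
    by_cases h : i + 1 < X.card
    · have h2 : e ⟨X.card - 1 - (i + 1), by omega⟩ < e ⟨X.card - 1 - i, by omega⟩ :=
        hmono (by simp only [Fin.mk_lt_mk]; omega)
      simp only [f, dif_pos h, dif_pos (show i < X.card by omega)]
      omega
    · simp [f, h]
  obtain ⟨μ, hμ⟩ := exists_rowLen_eq hf (L := X.card) (by simp [f])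
  have hiff : ∀ i, i < μ.colLen 0 ↔ i < X.card := by
    intro i
    rw [← rowLen_pos_iff, hμ]
    by_cases h : i < X.card
    · have := hpos (X.card - 1 - i) (by omega)
      simp only [f, dif_pos h, h, iff_true]
      omega
    · simp [f, h]
  have hL : μ.colLen 0 = X.card :=
    le_antisymm (le_of_not_gt fun hlt => lt_irrefl _ ((hiff _).1 hlt))
      (le_of_not_gt fun hlt => lt_irrefl _ ((hiff _).2 hlt))
  refine ⟨μ, Finset.eq_of_subset_of_card_le ?_ (by rw [card_betaSet, hL])⟩
  intro x hx
  obtain ⟨i, hi, rfl⟩ := mem_betaSet.1 hx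
  have hi' := (hiff i).1 hi
  have h1 := hpos (X.card - 1 - i) (by omega)
  have h2 : μ.bead i = e ⟨X.card - 1 - i, by omega⟩ := by
    rw [bead, hμ, hL]
    simp only [f, dif_pos hi']
    omega
  rw [h2]
  exact X.orderEmbOfFin_mem rfl _

end YoungDiagram

/-! ### Least gaps modulo a -/

/-- `v z` is the least natural number in the class `z` modulo `a` that is not in `X`, where `X` is
closed under subtraction of `a`. -/
structure IsApery {a : ℕ} (X : Finset ℕ) (v : ZMod a → ℕ) : Prop where
  cast_eq : ∀ z, (v z : ZMod a) = z
  mem_iff : ∀ x : ℕ, x ∈ X ↔ x < v x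

theorem exists_isApery {a : ℕ} [NeZero a] {X : Finset ℕ}
    (hX : ∀ x ∈ X, a ≤ x → x - a ∈ X) : ∃ v : ZMod a → ℕ, IsApery X v := by
  classical
  have hex : ∀ z : ZMod a, ∃ n : ℕ, (n : ZMod a) = z ∧ n ∉ X := by
    intro z
    -- A representative of `z` above every element of `X`.
    refine ⟨z.val + a * (X.sup id + 1), by simp, fun h => ?_⟩
    have h1 : z.val + a * (X.sup id + 1) ≤ X.sup id := Finset.le_sup (f := id) h
    have h2 : 1 * (X.sup id + 1) ≤ a * (X.sup id + 1) :=
      Nat.mul_le_mul_right _ (NeZero.pos a)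
    omega
  have hdown : ∀ t n : ℕ, n + a * t ∈ X → n ∈ X := by
    intro t n
    induction t with
    | zero => simp
    | succ t ih =>
      intro h
      apply ih
      have h1 := hX _ h (by rw [mul_add]; omega)
      have h2 : n + a * (t + 1) - a = n + a * t := by rw [mul_add]; omega
      rwa [h2] at h1
  refine ⟨fun z => Nat.find (hex z), fun z => (Nat.find_spec (hex z)).1, fun x => ⟨?_, ?_⟩⟩
  · intro hx
    by_contra hle
    have hspec := Nat.find_spec (hex x)
    rw [not_lt] at hle
    obtain ⟨t, ht⟩ := (Nat.modEq_iff_dvd' hle).1 ((ZMod.natCast_eq_natCast_iff _ _ _).1 hspec.1)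
    refine hspec.2 (hdown t _ ?_)
    rw [← ht, Nat.add_sub_cancel' hle]
    exact hx
  · intro hx
    by_contra hn
    exact Nat.find_min (hex x) hx ⟨rfl, hn⟩

theorem exists_finset_isApery {a : ℕ} [NeZero a] {v : ZMod a → ℕ}
    (hv : ∀ z, (v z : ZMod a) = z) : ∃ X : Finset ℕ, IsApery X v := by
  classical
  refine ⟨(Finset.range (Finset.univ.sup v)).filter (fun x => x < v x), hv, fun x => ?_⟩
  simp only [Finset.mem_filter, Finset.mem_range, and_iff_right_iff_imp]
  exact fun h => h.trans_le (Finset.le_sup (Finset.mem_univ _))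

namespace IsApery

variable {a : ℕ} {X : Finset ℕ} {v : ZMod a → ℕ}

theorem apply_zero (h : IsApery X v) (h0 : 0 ∉ X) : v 0 = 0 := by
  have := mt (h.mem_iff 0).2 h0
  simpa using this

/-- In each class, `X` is everything below the gap `v z`; were `v z + t` in `X`, subtracting t would
put `v z` itself in `X`. -/
theorem closed_iff (h : IsApery X v) (t : ℕ) :
    (∀ x ∈ X, t ≤ x → x - t ∈ X) ↔ ∀ z, v (z + t) ≤ v z + t := by
  constructor
  · intro hX z
    by_contra hlt
    rw [not_le] at hlt
    have h1 : v z + t ∈ X := by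
      rw [h.mem_iff]
      simpa [h.cast_eq] using hlt
    have h2 := hX _ h1 (by omega)
    rw [Nat.add_sub_cancel, h.mem_iff, h.cast_eq] at h2
    exact lt_irrefl _ h2
  · intro hv x hx htx
    rw [h.mem_iff] at hx ⊢
    have h1 := hv ((x - t : ℕ) : ZMod a)
    rw [← Nat.cast_add, Nat.sub_add_cancel htx] at h1
    omega

theorem eq_of_apply (h : IsApery X v) {Y : Finset ℕ} (h' : IsApery Y v) : X = Y := by
  ext x
  rw [h.mem_iff, h'.mem_iff]

theorem val_add_mul_div (h : IsApery X v) (z : ZMod a) : z.val + a * (v z / a) = v z := by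
  have h1 : z.val = v z % a := by
    conv_lhs => rw [← h.cast_eq z]
    exact ZMod.val_natCast a (v z)
  rw [h1]
  exact Nat.mod_add_div _ _

theorem sum_eq [NeZero a] (h : IsApery X v) {M : Type*} [AddCommMonoid M] (g : ℕ → M) :
    ∑ x ∈ X, g x = ∑ z : ZMod a, ∑ t ∈ Finset.range (v z / a), g (z.val + a * t) := by
  rw [Finset.sum_sigma']
  refine Finset.sum_bij' (fun x _ => (⟨(x : ZMod a), x / a⟩ : Σ _ : ZMod a, ℕ))
    (fun p _ => p.1.val + a * p.2) ?_ ?_ ?_ ?_ ?_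
  · intro x hx
    simp only [Finset.mem_sigma, Finset.mem_univ, Finset.mem_range, true_and]
    rw [h.mem_iff] at hx
    have h1 := h.val_add_mul_div (x : ZMod a)
    rw [ZMod.val_natCast] at h1
    have h2 := Nat.mod_add_div x a
    by_contra hle
    have := Nat.mul_le_mul_left a (not_lt.1 hle)
    omega
  · rintro ⟨z, t⟩ hp
    simp only [Finset.mem_sigma, Finset.mem_univ, Finset.mem_range, true_and] at hp
    rw [h.mem_iff]
    have h1 := h.val_add_mul_div z
    have h2 : ((z.val + a * t : ℕ) : ZMod a) = z := by simp
    rw [h2]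
    have := Nat.mul_lt_mul_of_pos_left hp (NeZero.pos a)
    simp only
    omega
  · intro x _
    simp only [ZMod.val_natCast]
    exact Nat.mod_add_div x a
  · rintro ⟨z, t⟩ _
    have h1 : (z.val + a * t) / a = t := by
      rw [Nat.add_mul_div_left _ _ (NeZero.pos a), Nat.div_eq_of_lt z.val_lt, zero_add]
    simp [h1]
  · intro x _
    simp only [ZMod.val_natCast]
    rw [Nat.mod_add_div]

end IsApery

/-! ### Size as a variance -/

theorem two_mul_sum_range_add_mul (r a c : ℤ) (n : ℕ) (hn : (n : ℤ) = c) :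
    2 * ∑ t ∈ Finset.range n, (r + a * t) = 2 * c * r + a * c * (c - 1) := by
  subst hn
  induction n with
  | zero => simp
  | succ n ih =>
    rw [Finset.sum_range_succ, mul_add, ih]
    push_cast
    ring

theorem ZMod.sum_val {a : ℕ} [NeZero a] {M : Type*} [AddCommMonoid M] (g : ℕ → M) :
    ∑ z : ZMod a, g z.val = ∑ r ∈ Finset.range a, g r := by
  refine Finset.sum_bij' (fun z _ => z.val) (fun r _ => (r : ZMod a)) ?_ ?_ ?_ ?_ ?_
  · intro z _
    simpa using z.val_lt
  · simp
  · simp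
  · intro r hr
    exact ZMod.val_natCast_of_lt (Finset.mem_range.1 hr)
  · simp

theorem six_mul_sum_range_sq (n : ℕ) :
    6 * ∑ r ∈ Finset.range n, (r : ℤ) ^ 2 = n * (n - 1) * (2 * n - 1) := by
  induction n with
  | zero => simp
  | succ n ih =>
    rw [Finset.sum_range_succ, mul_add, ih]
    push_cast
    ring

theorem two_mul_sum_range_id (n : ℕ) :
    2 * ∑ r ∈ Finset.range n, (r : ℤ) = n * (n - 1) := by
  induction n with
  | zero => simp
  | succ n ih =>
    rw [Finset.sum_range_succ, mul_add, ih]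
    push_cast
    ring

/-- `card ι` times the sum of squares minus the square of the sum: `(card ι) ^ 2` times the
variance. -/
def scaledVariance {ι : Type*} [Fintype ι] (u : ι → ℤ) : ℤ :=
  Fintype.card ι * ∑ i, u i ^ 2 - (∑ i, u i) ^ 2

/-- A class with residue r and least gap w holds (w - r)/a beads, and 2a times their sum is w² - r²
- a(w - r). After summation the terms linear in Σ w cancel because 2 Σ r = a(a - 1). -/
theorem IsApery.card_eq {a : ℕ} [NeZero a] {μ : YoungDiagram} {v : ZMod a → ℕ}
    (h : IsApery μ.betaSet v) :
    24 * (a : ℤ) ^ 2 * μ.card =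
      12 * scaledVariance (fun z => (v z : ℤ)) - a ^ 2 * (a ^ 2 - 1) := by
  have hcell : ∀ z, (z.val : ℤ) + a * (v z / a : ℕ) = v z := fun z => by
    exact_mod_cast h.val_add_mul_div z
  have hcard : (a : ℤ) * μ.betaSet.card = ∑ z, (v z : ℤ) - ∑ z : ZMod a, (z.val : ℤ) := by
    have h1 := h.sum_eq (fun _ => (1 : ℤ))
    simp only [Finset.sum_const, nsmul_eq_mul, mul_one, Finset.card_range] at h1
    rw [h1, Finset.mul_sum, ← Finset.sum_sub_distrib]
    exact Finset.sum_congr rfl fun z _ => by linarith [hcell z]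
  have hsum : 2 * (a : ℤ) * ∑ x ∈ μ.betaSet, (x : ℤ) =
      ∑ z, (v z : ℤ) ^ 2 - ∑ z : ZMod a, (z.val : ℤ) ^ 2 -
        a * (∑ z, (v z : ℤ) - ∑ z : ZMod a, (z.val : ℤ)) := by
    rw [h.sum_eq (fun x => (x : ℤ)), Finset.mul_sum, ← Finset.sum_sub_distrib,
      ← Finset.sum_sub_distrib, Finset.mul_sum, ← Finset.sum_sub_distrib]
    refine Finset.sum_congr rfl fun z _ => ?_
    have h1 := two_mul_sum_range_add_mul z.val a _ (v z / a) rfl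
    have h2 := hcell z
    generalize v z / a = c at h1 h2 ⊢
    push_cast
    rw [mul_comm 2 (a : ℤ), mul_assoc, h1, ← h2]
    ring
  have hsize : 2 * (μ.card : ℤ) + μ.betaSet.card * (μ.betaSet.card - 1) =
      2 * ∑ x ∈ μ.betaSet, (x : ℤ) := by
    have h1 := μ.card_add_choose_eq_sum_betaSet
    have h2 : (2 * μ.betaSet.card.choose 2 : ℤ) = μ.betaSet.card * (μ.betaSet.card - 1) := by
      rw [Nat.choose_two_right, ← Finset.sum_range_id, ← two_mul_sum_range_id]
      push_cast
      rfl
    rw [← h2, ← mul_add]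
    have h3 : ((μ.card + μ.betaSet.card.choose 2 : ℕ) : ℤ) = ∑ x ∈ μ.betaSet, (x : ℤ) := by
      rw [h1]
      push_cast
      rfl
    rw [← h3]
    push_cast
    rfl
  have hr1 : 2 * ∑ z : ZMod a, (z.val : ℤ) = a * (a - 1) := by
    rw [ZMod.sum_val (fun r => (r : ℤ)), two_mul_sum_range_id]
  have hr2 : 6 * ∑ z : ZMod a, (z.val : ℤ) ^ 2 = a * (a - 1) * (2 * a - 1) := by
    rw [ZMod.sum_val (fun r => (r : ℤ) ^ 2), six_mul_sum_range_sq]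
  unfold scaledVariance
  rw [ZMod.card]
  generalize (∑ z : ZMod a, (z.val : ℤ)) = R at *
  generalize (∑ z : ZMod a, (z.val : ℤ) ^ 2) = R2 at *
  generalize (∑ z, (v z : ℤ)) = W at *
  generalize (∑ z, (v z : ℤ) ^ 2) = W2 at *
  generalize (∑ x ∈ μ.betaSet, (x : ℤ)) = S at *
  generalize (μ.betaSet.card : ℤ) = L at *
  generalize (μ.card : ℤ) = N at *
  generalize (a : ℤ) = A at *
  have e : 24 * A ^ 2 * N = 12 * A * (2 * A * S) - 12 * (A * L) ^ 2 + 12 * A * (A * L) := by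
    linear_combination 12 * A ^ 2 * hsize
  rw [e, hcard, hsum]
  linear_combination (6 * A * (A - 1) + 12 * W - 3 * (2 * R + A * (A - 1))) * hr1 - 2 * A * hr2

theorem two_mul_scaledVariance {ι : Type*} [Fintype ι] (u : ι → ℤ) :
    2 * scaledVariance u = ∑ i, ∑ j, (u j - u i) ^ 2 := by
  have h : ∀ i, ∑ j, (u j - u i) ^ 2 =
      ∑ j, u j ^ 2 - 2 * u i * ∑ j, u j + Fintype.card ι * u i ^ 2 := by
    intro i
    have h1 : ∀ j, (u j - u i) ^ 2 = u j ^ 2 - 2 * u i * u j + u i ^ 2 := fun j => by ring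
    simp only [h1, Finset.sum_add_distrib, Finset.sum_sub_distrib, ← Finset.mul_sum,
      Finset.sum_const, Finset.card_univ, nsmul_eq_mul]
  simp only [h, Finset.sum_add_distrib, Finset.sum_sub_distrib, ← Finset.mul_sum,
    ← Finset.sum_mul, Finset.sum_const, Finset.card_univ, nsmul_eq_mul, scaledVariance]
  ring

theorem scaledVariance_comp_equiv {ι κ : Type*} [Fintype ι] [Fintype κ] (e : ι ≃ κ) (u : κ → ℤ) :
    scaledVariance (fun i => u (e i)) = scaledVariance u := by
  unfold scaledVariance
  rw [Fintype.card_congr e, e.sum_comp (fun k => u k ^ 2), e.sum_comp u]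

/-! ### Variance on a cycle with bounded steps -/

section Cyclic

variable {a : ℕ} {u : ZMod a → ℤ} {b : ℤ}

theorem apply_add_natCast_le (hu : ∀ i, u (i + 1) ≤ u i + b)
    (i : ZMod a) (n : ℕ) :
    u (i + n) ≤ u i + n * b := by
  induction n with
  | zero => simp
  | succ n ih =>
    have h := hu (i + n)
    push_cast
    rw [← add_assoc]
    linarith

/-- The remaining a - n steps lead from i + n back to i. -/
theorem apply_le_add_natCast (hu : ∀ i, u (i + 1) ≤ u i + b)
    (i : ZMod a) {n : ℕ} (hn : n ≤ a) :
    u i ≤ u (i + n) + (a - n) * b := by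
  have h := apply_add_natCast_le hu (i + n) (a - n)
  rw [Nat.cast_sub hn, Nat.cast_sub hn] at h
  simpa using h

/-- The defect in the upper bound for the square of a difference at cyclic distance `l`. -/
def lagDefect (u : ZMod a → ℤ) (b : ℤ) (l : ℕ) (i : ZMod a) : ℤ :=
  (l * b - (u (i + l) - u i)) * (u (i + l) - u i + (a - l) * b)

theorem lagDefect_nonneg (hu : ∀ i, u (i + 1) ≤ u i + b) {l : ℕ} (hl : l ≤ a) (i : ZMod a) :
    0 ≤ lagDefect u b l i := by
  have h1 := apply_add_natCast_le hu i l
  have h2 := apply_le_add_natCast hu i hl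
  exact mul_nonneg (by linarith) (by linarith)

variable [NeZero a]

/-- The sum of the squares of the differences of `u` at cyclic distance `l`. -/
def lagSum (u : ZMod a → ℤ) (l : ℕ) : ℤ :=
  ∑ i, (u (i + l) - u i) ^ 2

theorem two_mul_scaledVariance_eq_sum_lagSum (u : ZMod a → ℤ) :
    2 * scaledVariance u = ∑ l ∈ Finset.range a, lagSum u l := by
  have h : ∀ i, ∑ j, (u j - u i) ^ 2 = ∑ d, (u (i + d) - u i) ^ 2 := fun i =>
    (Equiv.sum_comp (Equiv.addLeft i) fun j => (u j - u i) ^ 2).symm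
  rw [two_mul_scaledVariance, ← ZMod.sum_val (lagSum u)]
  simp only [h]
  rw [Finset.sum_comm]
  simp [lagSum]

theorem sum_shift_sub (u : ZMod a → ℤ) (d : ZMod a) : ∑ i, (u (i + d) - u i) = 0 := by
  rw [Finset.sum_sub_distrib, sub_eq_zero]
  exact Equiv.sum_comp (Equiv.addRight d) u

theorem lagSum_sub (u : ZMod a → ℤ) {l : ℕ} (hl : l ≤ a) : lagSum u (a - l) = lagSum u l := by
  unfold lagSum
  rw [← Equiv.sum_comp (Equiv.addRight (l : ZMod a))]
  refine Finset.sum_congr rfl fun i _ => ?_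
  have h : i + (l : ZMod a) + ((a - l : ℕ) : ZMod a) = i := by
    rw [Nat.cast_sub hl]
    simp
  simp only [Equiv.coe_addRight, h]
  ring

/-- The defect is quadratic in the difference with leading coefficient -1, and its linear part sums
to zero around the cycle. -/
theorem lagSum_add_sum_lagDefect (u : ZMod a → ℤ) (b : ℤ) (l : ℕ) :
    lagSum u l + ∑ i, lagDefect u b l i = a * b ^ 2 * (l * (a - l)) := by
  have h : ∀ i, (u (i + l) - u i) ^ 2 + lagDefect u b l i =
      l * (a - l) * b ^ 2 + (2 * l - a) * b * (u (i + l) - u i) := by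
    intro i
    unfold lagDefect
    ring
  rw [lagSum, ← Finset.sum_add_distrib]
  simp only [h]
  rw [Finset.sum_add_distrib, Finset.sum_const, ← Finset.mul_sum, sum_shift_sub,
    Finset.card_univ, ZMod.card, nsmul_eq_mul]
  ring

theorem scaledVariance_add_sum_lagDefect (u : ZMod a → ℤ) (b : ℤ) :
    12 * scaledVariance u + 6 * ∑ l ∈ Finset.range a, ∑ i, lagDefect u b l i =
      a ^ 2 * b ^ 2 * (a ^ 2 - 1) := by
  have h1 : 2 * scaledVariance u + ∑ l ∈ Finset.range a, ∑ i, lagDefect u b l i =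
      a * b ^ 2 * ∑ l ∈ Finset.range a, ((l : ℤ) * (a - l)) := by
    rw [two_mul_scaledVariance_eq_sum_lagSum, ← Finset.sum_add_distrib, Finset.mul_sum]
    exact Finset.sum_congr rfl fun l _ => lagSum_add_sum_lagDefect u b l
  have h2 : ∑ l ∈ Finset.range a, ((l : ℤ) * (a - l)) =
      a * ∑ l ∈ Finset.range a, (l : ℤ) - ∑ l ∈ Finset.range a, (l : ℤ) ^ 2 := by
    rw [Finset.mul_sum, ← Finset.sum_sub_distrib]
    exact Finset.sum_congr rfl fun l _ => by ring
  rw [h2] at h1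
  linear_combination 6 * h1 + 3 * a ^ 2 * b ^ 2 * two_mul_sum_range_id a -
    a * b ^ 2 * six_mul_sum_range_sq a

theorem scaledVariance_le (hu : ∀ i, u (i + 1) ≤ u i + b) :
    12 * scaledVariance u ≤ a ^ 2 * b ^ 2 * (a ^ 2 - 1) := by
  have h := scaledVariance_add_sum_lagDefect u b
  have h0 : 0 ≤ ∑ l ∈ Finset.range a, ∑ i, lagDefect u b l i :=
    Finset.sum_nonneg fun l hl => Finset.sum_nonneg fun i _ =>
      lagDefect_nonneg hu (Finset.mem_range.1 hl).le i
  linarith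

/-- Equality makes every defect vanish. Lag 1 suffices: its defect is the product of the two
alternatives. -/
theorem step_of_scaledVariance_eq (hu : ∀ i, u (i + 1) ≤ u i + b) (ha : 1 < a)
    (h : 12 * scaledVariance u = a ^ 2 * b ^ 2 * (a ^ 2 - 1)) (i : ZMod a) :
    u (i + 1) = u i + b ∨ u (i + 1) = u i + b - a * b := by
  have h1 := scaledVariance_add_sum_lagDefect u b
  have h2 : ∑ l ∈ Finset.range a, ∑ i, lagDefect u b l i = 0 := by linarith
  have h3 := (Finset.sum_eq_zero_iff_of_nonneg fun l hl => Finset.sum_nonneg fun i _ =>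
      lagDefect_nonneg hu (Finset.mem_range.1 hl).le i).1 h2 1 (Finset.mem_range.2 ha)
  have h4 := (Finset.sum_eq_zero_iff_of_nonneg fun i _ =>
      lagDefect_nonneg hu ha.le i).1 h3 i (Finset.mem_univ i)
  unfold lagDefect at h4
  push_cast at h4
  rcases mul_eq_zero.1 h4 with h5 | h5
  · left
    linarith
  · right
    linarith

theorem apply_natCast_of_scaledVariance_eq (hu : ∀ i, u (i + 1) ≤ u i + b) (hb : 0 < b)
    (hnonneg : ∀ i, 0 ≤ u i) (h0 : u 0 = 0)
    (h : 12 * scaledVariance u = a ^ 2 * b ^ 2 * (a ^ 2 - 1)) {n : ℕ} (hn : n < a) :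
    u n = n * b := by
  induction n with
  | zero => simpa using h0
  | succ n ih =>
    have ih := ih (by omega)
    push_cast
    rcases step_of_scaledVariance_eq hu (by omega) h (n : ZMod a) with h1 | h1
    · rw [h1, ih]
      ring
    -- A drop here would give the value (n + 1 - a) b, which is negative.
    · exfalso
      have h2 := hnonneg ((n : ZMod a) + 1)
      have h3 : ((n : ℤ) + 1) < a := by exact_mod_cast hn
      rw [h1, ih] at h2
      nlinarith

/-- A family of pairwise intersecting arcs of length `l` on a cycle of length at least `2 * l` has
at most `l` members. -/
theorem card_le_of_intersecting_arcs {l : ℕ} (hl : 2 * l ≤ a) {F : Finset (ZMod a)}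
    (hF : ∀ i ∈ F, ∀ j ∈ F, l ≤ (j - i).val → a - l < (j - i).val) : F.card ≤ l := by
  rcases F.eq_empty_or_nonempty with rfl | ⟨i₀, hi₀⟩
  · simp
  have hl0 : 0 < l := by
    by_contra h
    have := hF i₀ hi₀ i₀ hi₀
    simp only [sub_self, ZMod.val_zero] at this
    omega
  let d : ZMod a → ℕ := fun i => (i - i₀).val
  have hd : ∀ i, d i < a := fun i => ZMod.val_lt _
  have hinj : ∀ i j, d i = d j → i = j := fun i j h => by
    simpa using ZMod.val_injective a h
  have hsub : ∀ i j, d i ≤ d j → (j - i).val = d j - d i := by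
    intro i j h
    rw [← ZMod.val_sub h]
    congr 1
    ring
  rw [← Finset.card_range l]
  -- Positions relative to `i₀` lie in [0, l) or (a - l, a); the latter are shifted by l - a. A
  -- collision would need two arcs at distance exactly a - l, and those are disjoint.
  refine Finset.card_le_card_of_injOn (fun i => if d i < l then d i else d i + l - a) ?_ ?_
  · intro i hi
    have h1 := hF i₀ hi₀ i hi
    have h2 := hd i
    simp only [Finset.coe_range, Set.mem_Iio]
    change l ≤ d i → a - l < d i at h1
    split_ifs <;> omega
  · intro i hi j hj hij
    have h1 := hF i₀ hi₀ i hi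
    have h2 := hF i₀ hi₀ j hj
    change l ≤ d i → a - l < d i at h1
    change l ≤ d j → a - l < d j at h2
    have h3 := hF i hi j hj
    have h4 := hF j hj i hi
    have h5 := hd i
    have h6 := hd j
    apply hinj
    rcases le_total (d i) (d j) with h | h
    · rw [hsub i j h] at h3
      simp only at hij
      split_ifs at hij <;> omega
    · rw [hsub j i h] at h4
      simp only at hij
      split_ifs at hij <;> omega

end Cyclic

/-! ### Sharper variance bound from the middle modulus -/

section Consecutive

variable {m : ℕ} {u : ZMod (2 * m + 1) → ℤ}

theorem lagSum_le_of_steps (hu : ∀ i, u (i + 1) ≤ u i + (2 * m + 3))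
    (hs : ∀ i, u (i + (m + 1 : ℕ)) ≤ u i + (2 * m + 2))
    (hmod : ∀ i, ((u i : ℤ) : ZMod (2 * m + 1)) = i * ((2 * m + 3 : ℤ) : ZMod (2 * m + 1)))
    {l : ℕ} (hl : l ≤ m) :
    lagSum u l ≤ (2 * m + 1) ^ 2 * ((m + 2) * (2 * m + 3) - (m + 1)) * l -
      (2 * m + 1) * (2 * m + 3) ^ 2 * l ^ 2 := by
  have hex : ∀ i, ∃ x : ℤ, u i + l * (2 * m + 3) - u (i + l) = (2 * m + 1) * x := by
    intro i
    have h : ((2 * m + 1 : ℕ) : ℤ) ∣ u i + l * (2 * m + 3) - u (i + l) := by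
      rw [← ZMod.intCast_zmod_eq_zero_iff_dvd]
      rw [Int.cast_sub, Int.cast_add, Int.cast_mul, hmod, hmod]
      push_cast
      ring
    simpa [dvd_def] using h
  choose x hx using hex
  have hA : (0 : ℤ) < 2 * m + 1 := by positivity
  have hx0 : ∀ i, 0 ≤ x i := by
    intro i
    have h := apply_add_natCast_le hu i l
    have h1 : 0 ≤ (2 * (m : ℤ) + 1) * x i := by linarith [hx i]
    exact nonneg_of_mul_nonneg_right h1 hA
  -- From i + l, one jump by m + 1 and m - l unit steps return to i, at total cost (2m + 1)(m + 2) -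
  -- l(2m + 3).
  have hx1 : ∀ i, x i ≤ m + 2 := by
    intro i
    have h1 := hs (i + l)
    have h2 := apply_add_natCast_le hu (i + l + (m + 1 : ℕ)) (m - l)
    have h3 : i + (l : ZMod (2 * m + 1)) + (m + 1 : ℕ) + (m - l : ℕ) = i := by
      have : ((l + (m + 1) + (m - l) : ℕ) : ZMod (2 * m + 1)) = 0 := by
        rw [show l + (m + 1) + (m - l) = 2 * m + 1 by omega]
        exact ZMod.natCast_self _
      rw [add_assoc, add_assoc, ← Nat.cast_add, ← Nat.cast_add, ← add_assoc, this, add_zero]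
    rw [h3, Nat.cast_sub hl] at h2
    refine le_of_mul_le_mul_left ?_ hA
    rw [← hx i]
    linarith
  have hsum : ∑ i, x i = l * (2 * m + 3) := by
    have h1 : ∑ i, (2 * (m : ℤ) + 1) * x i = ∑ i : ZMod (2 * m + 1),
        ((l : ℤ) * (2 * m + 3) - (u (i + l) - u i)) :=
      Finset.sum_congr rfl fun i _ => by rw [← hx i]; ring
    rw [← Finset.mul_sum, Finset.sum_sub_distrib, sum_shift_sub, Finset.sum_const,
      Finset.card_univ, ZMod.card, nsmul_eq_mul, sub_zero] at h1
    push_cast at h1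
    exact mul_left_cancel₀ hA.ne' h1
  -- If the arcs of length l from two such indices were disjoint, the unit steps across the two
  -- spaces between them would give 2(m + 2) ≤ 2m + 3.
  have hfull : (Finset.univ.filter fun i => x i = m + 2).card ≤ l := by
    refine card_le_of_intersecting_arcs (by omega) fun i hi j hj hlij => ?_
    by_contra hle
    rw [not_lt] at hle
    simp only [Finset.mem_filter, Finset.mem_univ, true_and] at hi hj
    obtain ⟨d, hd⟩ : ∃ d, d = (j - i).val := ⟨_, rfl⟩
    rw [← hd] at hlij hle
    have hj' : j = i + (d : ZMod (2 * m + 1)) := by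
      rw [hd, ZMod.natCast_val, ZMod.cast_id]
      ring
    have h1 := apply_add_natCast_le hu (i + l) (d - l)
    have h2 := apply_add_natCast_le hu (j + l) (2 * m + 1 - d - l)
    have e1 : i + (l : ZMod (2 * m + 1)) + (d - l : ℕ) = j := by
      rw [add_assoc, ← Nat.cast_add, Nat.add_sub_cancel' hlij, hj']
    have e2 : j + (l : ZMod (2 * m + 1)) + (2 * m + 1 - d - l : ℕ) = i := by
      rw [hj', add_assoc, add_assoc, ← Nat.cast_add, ← Nat.cast_add,
        show d + (l + (2 * m + 1 - d - l)) = 2 * m + 1 by omega, ZMod.natCast_self, add_zero]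
    rw [e1, Nat.cast_sub hlij] at h1
    rw [e2, Nat.cast_sub (by omega), Nat.cast_sub (by omega)] at h2
    push_cast at h2
    have h3 := hx i
    have h4 := hx j
    rw [hi] at h3
    rw [hj] at h4
    nlinarith
  -- An integer 0 ≤ x < m + 2 satisfies x ≤ x(m + 2 - x); by `hsum` and `hfull` such x sum to at
  -- least l(2m + 3) - l(m + 2).
  have hdef : (m + 1 : ℤ) * l ≤ ∑ i, x i * (m + 2 - x i) := by
    have hpt : ∀ i, x i - (if x i = m + 2 then (m + 2 : ℤ) else 0) ≤ x i * (m + 2 - x i) := by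
      intro i
      split_ifs with h
      · rw [h]
        simp
      · have h1 : x i + 1 ≤ m + 2 := lt_of_le_of_ne (hx1 i) h
        nlinarith [hx0 i]
    have h1 := Finset.sum_le_sum fun i (_ : i ∈ Finset.univ) => hpt i
    rw [Finset.sum_sub_distrib, hsum, ← Finset.sum_filter, Finset.sum_const, nsmul_eq_mul] at h1
    have h2 : ((Finset.univ.filter fun i => x i = m + 2).card : ℤ) ≤ l := by exact_mod_cast hfull
    nlinarith
  have hlag : lagSum u l = (2 * m + 1) * (l * (2 * m + 3)) ^ 2 +
      ((2 * m + 1) ^ 2 * (m + 2) - 2 * (l * (2 * m + 3)) * (2 * m + 1)) * ∑ i, x i -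
      (2 * m + 1) ^ 2 * ∑ i, x i * (m + 2 - x i) := by
    have h1 : ∀ i, (u (i + l) - u i) ^ 2 = (l * (2 * m + 3)) ^ 2 +
        ((2 * m + 1) ^ 2 * (m + 2) - 2 * (l * (2 * m + 3)) * (2 * m + 1)) * x i -
        (2 * m + 1) ^ 2 * (x i * (m + 2 - x i)) := by
      intro i
      have h2 : u (i + l) - u i = l * (2 * m + 3) - (2 * m + 1) * x i := by linarith [hx i]
      rw [h2]
      ring
    rw [lagSum]
    simp only [h1]
    rw [Finset.sum_sub_distrib, Finset.sum_add_distrib, ← Finset.mul_sum, ← Finset.mul_sum,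
      Finset.sum_const, Finset.card_univ, ZMod.card, nsmul_eq_mul]
    push_cast
    ring
  rw [hlag, hsum]
  have := mul_le_mul_of_nonneg_left hdef (sq_nonneg (2 * (m : ℤ) + 1))
  linarith

/-- The lags l and 2m + 1 - l contribute equally, so those up to m carry half of the double sum. -/
theorem scaledVariance_eq_sum_lagSum (u : ZMod (2 * m + 1) → ℤ) :
    scaledVariance u = ∑ l ∈ Finset.range (m + 1), lagSum u l := by
  have h := two_mul_scaledVariance_eq_sum_lagSum u
  have h0 : lagSum u 0 = 0 := by simp [lagSum]
  have h1 : ∑ j ∈ Finset.range m, lagSum u (m + 1 + j) =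
      ∑ j ∈ Finset.range m, lagSum u (j + 1) := by
    rw [← Finset.sum_range_reflect]
    refine Finset.sum_congr rfl fun j hj => ?_
    have hj := Finset.mem_range.1 hj
    rw [← lagSum_sub u (show j + 1 ≤ 2 * m + 1 by omega)]
    congr 1
    omega
  rw [show Finset.range (2 * m + 1) = Finset.range (m + 1 + m) by congr 1; omega,
    Finset.sum_range_add, h1] at h
  rw [Finset.sum_range_succ', h0, add_zero] at h ⊢
  linarith

theorem scaledVariance_le_of_steps (hu : ∀ i, u (i + 1) ≤ u i + (2 * m + 3))
    (hs : ∀ i, u (i + (m + 1 : ℕ)) ≤ u i + (2 * m + 2))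
    (hmod : ∀ i, ((u i : ℤ) : ZMod (2 * m + 1)) = i * ((2 * m + 3 : ℤ) : ZMod (2 * m + 1))) :
    3 * scaledVariance u ≤ (2 * m + 1) ^ 2 * (m * (m + 1) * (m ^ 2 + 3 * m + 3)) := by
  have h := Finset.sum_le_sum fun l (hl : l ∈ Finset.range (m + 1)) =>
    lagSum_le_of_steps hu hs hmod (Nat.lt_succ_iff.1 (Finset.mem_range.1 hl))
  rw [← scaledVariance_eq_sum_lagSum, Finset.sum_sub_distrib, ← Finset.mul_sum,
    ← Finset.mul_sum] at h
  have h1 := two_mul_sum_range_id (m + 1)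
  have h2 := six_mul_sum_range_sq (m + 1)
  push_cast at h1 h2
  have h3 : (2 : ℤ) * (3 * scaledVariance u) ≤
      2 * ((2 * m + 1) ^ 2 * (m * (m + 1) * (m ^ 2 + 3 * m + 3))) := by
    linear_combination 6 * h + 3 * (2 * m + 1) ^ 2 * ((m + 2) * (2 * m + 3) - (m + 1)) * h1 -
      (2 * m + 1) * (2 * m + 3) ^ 2 * h2
  linarith

end Consecutive

/-! ### Core conditions in terms of least gaps -/

namespace YoungDiagram

theorem isSimultaneousCore_pair {μ : YoungDiagram} {a b : ℕ} :
    μ.IsSimultaneousCore {a, b} ↔ μ.IsCore a ∧ μ.IsCore b := by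
  simp [IsSimultaneousCore]

theorem isSimultaneousCore_triple {μ : YoungDiagram} {a s b : ℕ} :
    μ.IsSimultaneousCore {a, s, b} ↔ μ.IsCore a ∧ μ.IsCore s ∧ μ.IsCore b := by
  simp [IsSimultaneousCore]

theorem IsCore.exists_isApery {a : ℕ} [NeZero a] {μ : YoungDiagram} (h : μ.IsCore a) :
    ∃ v : ZMod a → ℕ, IsApery μ.betaSet v :=
  _root_.exists_isApery ((isCore_iff_betaSet (NeZero.pos a)).1 h)

theorem exists_isApery_betaSet {a : ℕ} [NeZero a] {v : ZMod a → ℕ}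
    (hv : ∀ z, (v z : ZMod a) = z) (h0 : v 0 = 0) :
    ∃ μ : YoungDiagram, IsApery μ.betaSet v := by
  obtain ⟨X, hX⟩ := exists_finset_isApery hv
  obtain ⟨μ, rfl⟩ := exists_betaSet_eq (X := X) (by rw [hX.mem_iff]; simp [h0])
  exact ⟨μ, hX⟩

end YoungDiagram

open YoungDiagram

theorem IsApery.isCore_iff {a : ℕ} {μ : YoungDiagram} {v : ZMod a → ℕ}
    (h : IsApery μ.betaSet v) {t : ℕ} (ht : 0 < t) :
    μ.IsCore t ↔ ∀ z, v (z + t) ≤ v z + t := by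
  rw [isCore_iff_betaSet ht, h.closed_iff]

theorem IsApery.isCore_modulus {a : ℕ} [NeZero a] {μ : YoungDiagram} {v : ZMod a → ℕ}
    (h : IsApery μ.betaSet v) : μ.IsCore a := by
  rw [h.isCore_iff (NeZero.pos a)]
  simp

theorem IsApery.step_mul {a b : ℕ} {μ : YoungDiagram} {v : ZMod a → ℕ}
    (h : IsApery μ.betaSet v)
    (hb : 0 < b) (hμ : μ.IsCore b) (i : ZMod a) :
    (v ((i + 1) * b) : ℤ) ≤ v (i * b) + b := by
  have h1 := (h.isCore_iff hb).1 hμ (i * b)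
  rw [add_mul, one_mul]
  exact_mod_cast h1

/-! ### Largest (a, b)-cores for coprime a and b -/

section Coprime

variable {a b : ℕ} [NeZero a]

theorem scaledVariance_comp_mul (hab : b.Coprime a) (u : ZMod a → ℤ) :
    scaledVariance (fun i => u (i * b)) = scaledVariance u := by
  have := scaledVariance_comp_equiv (Units.mulRight (ZMod.unitOfCoprime b hab)) u
  simpa using this

theorem IsApery.card_eq_iff (hab : b.Coprime a) {μ : YoungDiagram} {v : ZMod a → ℕ}
    (h : IsApery μ.betaSet v) (n : ℤ) :
    24 * (μ.card : ℤ) = n - (a ^ 2 - 1) ↔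
      12 * scaledVariance (fun i : ZMod a => (v (i * b) : ℤ)) = a ^ 2 * n := by
  have ha : (a : ℤ) ^ 2 ≠ 0 := pow_ne_zero 2 (by exact_mod_cast NeZero.ne a)
  have h1 := h.card_eq
  rw [scaledVariance_comp_mul hab fun z => (v z : ℤ)]
  constructor
  · intro h2
    linear_combination -h1 + (a : ℤ) ^ 2 * h2
  · intro h2
    apply mul_left_cancel₀ ha
    linear_combination h1 + h2

theorem card_le_of_isCore (hab : b.Coprime a) (hb : 0 < b) {μ : YoungDiagram}
    (hμa : μ.IsCore a) (hμb : μ.IsCore b) :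
    24 * (μ.card : ℤ) ≤ (a ^ 2 - 1) * (b ^ 2 - 1) := by
  obtain ⟨v, hv⟩ := hμa.exists_isApery
  have h1 := scaledVariance_le (u := fun i : ZMod a => (v (i * b) : ℤ)) (hv.step_mul hb hμb)
  rw [scaledVariance_comp_mul hab fun z => (v z : ℤ)] at h1
  have h2 := hv.card_eq
  have ha : (0 : ℤ) < (a : ℤ) ^ 2 := pow_pos (by exact_mod_cast NeZero.pos a) 2
  refine le_of_mul_le_mul_left ?_ ha
  linear_combination h1 + h2

theorem IsApery.apply_of_card_eq (hab : b.Coprime a) (hb : 0 < b) {μ : YoungDiagram}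
    {v : ZMod a → ℕ} (hv : IsApery μ.betaSet v) (hμb : μ.IsCore b)
    (h : 24 * (μ.card : ℤ) = (a ^ 2 - 1) * (b ^ 2 - 1)) (i : ZMod a) :
    v (i * b) = i.val * b := by
  have h1 := apply_natCast_of_scaledVariance_eq (u := fun i : ZMod a => (v (i * b) : ℤ))
    (hv.step_mul hb hμb) (by exact_mod_cast hb) (fun i => Int.natCast_nonneg _)
    (by simp [hv.apply_zero μ.zero_notMem_betaSet])
    (by rw [mul_assoc]
        exact (hv.card_eq_iff hab _).1 (by rw [h]; ring)) i.val_lt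
  simp only [ZMod.natCast_zmod_val] at h1
  exact_mod_cast h1

theorem eq_of_card_eq (hab : b.Coprime a) (hb : 0 < b) {μ ν : YoungDiagram}
    (hμa : μ.IsCore a) (hμb : μ.IsCore b) (hνa : ν.IsCore a) (hνb : ν.IsCore b)
    (hμ : 24 * (μ.card : ℤ) = (a ^ 2 - 1) * (b ^ 2 - 1))
    (hν : 24 * (ν.card : ℤ) = (a ^ 2 - 1) * (b ^ 2 - 1)) : μ = ν := by
  obtain ⟨v, hv⟩ := hμa.exists_isApery
  obtain ⟨w, hw⟩ := hνa.exists_isApery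
  have hvw : v = w := by
    funext z
    obtain ⟨i, rfl⟩ := (Units.mulRight (ZMod.unitOfCoprime b hab)).surjective z
    simp only [Units.mulRight_apply, ZMod.coe_unitOfCoprime]
    rw [hv.apply_of_card_eq hab hb hμb hμ, hw.apply_of_card_eq hab hb hνb hν]
  subst hvw
  exact betaSet_injective (hv.eq_of_apply hw)

theorem exists_isCore_card_eq (hab : b.Coprime a) (hb : 0 < b) :
    ∃ μ : YoungDiagram, μ.IsCore a ∧ μ.IsCore b ∧
      24 * (μ.card : ℤ) = (a ^ 2 - 1) * (b ^ 2 - 1) := by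
  have hbb : (b : ZMod a) * (b : ZMod a)⁻¹ = 1 := ZMod.coe_mul_inv_eq_one b hab
  -- The profile forced by `apply_natCast_of_scaledVariance_eq`: for 0 ≤ i < a, the class of i b has
  -- least gap i b.
  obtain ⟨μ, hμ⟩ := exists_isApery_betaSet (a := a)
    (v := fun z => (z * (b : ZMod a)⁻¹).val * b)
    (fun z => by
      rw [Nat.cast_mul, ZMod.natCast_val, ZMod.cast_id, mul_assoc, mul_comm _ (b : ZMod a), hbb,
        mul_one])
    (by simp)
  refine ⟨μ, hμ.isCore_modulus, (hμ.isCore_iff hb).2 fun z => ?_, ?_⟩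
  · rw [add_mul, hbb, ← Nat.succ_mul]
    refine Nat.mul_le_mul_right _ ((ZMod.val_add_le _ _).trans ?_)
    have : (1 : ZMod a).val ≤ 1 := by
      rw [ZMod.val_one_eq_one_mod]
      exact Nat.mod_le _ _
    omega
  · have key : 12 * scaledVariance (fun i : ZMod a =>
        (((i * b * (b : ZMod a)⁻¹).val * b : ℕ) : ℤ)) = a ^ 2 * (b ^ 2 * (a ^ 2 - 1)) := by
      simp only [mul_assoc, hbb, mul_one, scaledVariance, Nat.cast_mul, mul_pow, ZMod.card]
      rw [← Finset.sum_mul, ← Finset.sum_mul, ZMod.sum_val (fun r => (r : ℤ)),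
        ZMod.sum_val (fun r => (r : ℤ) ^ 2)]
      have h1 := two_mul_sum_range_id a
      have h2 := six_mul_sum_range_sq a
      linear_combination 2 * (a : ℤ) * b ^ 2 * h2 -
        3 * (b : ℤ) ^ 2 * (2 * ∑ r ∈ Finset.range a, (r : ℤ) + a * (a - 1)) * h1
    rw [(hμ.card_eq_iff hab _).2 key]
    ring

end Coprime

/-! ### Largest cores for three consecutive moduli -/

section Consecutive

variable {m : ℕ}

theorem coprime_two_mul_add (m : ℕ) : (2 * m + 3).Coprime (2 * m + 1) := by
  rw [show 2 * m + 3 = 2 + (2 * m + 1) by omega, Nat.coprime_add_self_left]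
  exact Nat.coprime_two_left.2 ⟨m, rfl⟩

theorem card_le_of_isCore_consecutive {μ : YoungDiagram} (h₁ : μ.IsCore (2 * m + 1))
    (h₂ : μ.IsCore (2 * m + 2)) (h₃ : μ.IsCore (2 * m + 3)) :
    6 * (μ.card : ℤ) ≤ m * (m + 1) ^ 2 * (m + 2) := by
  obtain ⟨v, hv⟩ := h₁.exists_isApery
  have hs := (hv.isCore_iff (by omega)).1 h₂
  -- Modulo 2m + 1 the other two moduli are 1 and 2, so adding 2m + 2 amounts to m + 1 unit steps
  -- after reindexing by 2m + 3.
  have hcast : ((m + 1 : ℕ) : ZMod (2 * m + 1)) * (2 * m + 3 : ℕ) = (2 * m + 2 : ℕ) := by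
    rw [← Nat.cast_mul, show (m + 1) * (2 * m + 3) = 2 * m + 2 + (2 * m + 1) * (m + 1) by ring,
      Nat.cast_add, Nat.cast_mul, ZMod.natCast_self, zero_mul, add_zero]
  have h := scaledVariance_le_of_steps
    (u := fun i : ZMod (2 * m + 1) => (v (i * (2 * m + 3 : ℕ)) : ℤ))
    (fun i => by exact_mod_cast hv.step_mul (by omega) h₃ i)
    (fun i => by
      simp only [add_mul, hcast]
      exact_mod_cast hs (i * (2 * m + 3 : ℕ)))
    (fun i => by
      simp only [Int.cast_natCast, hv.cast_eq]
      push_cast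
      rfl)
  rw [scaledVariance_comp_mul (coprime_two_mul_add m) fun z => (v z : ℤ)] at h
  have h' := hv.card_eq
  push_cast at h'
  have ha : (0 : ℤ) < 4 * (2 * (m : ℤ) + 1) ^ 2 := by positivity
  refine le_of_mul_le_mul_left ?_ ha
  linear_combination 4 * h + h'

theorem sum_range_two_mul_add_one (g : ℕ → ℤ) (n : ℕ) :
    ∑ r ∈ Finset.range (2 * n + 1), g r =
      g 0 + ∑ j ∈ Finset.range n, (g (2 * j + 1) + g (2 * j + 2)) := by
  induction n with
  | zero => simp
  | succ n ih =>
    rw [show 2 * (n + 1) + 1 = 2 * n + 1 + 1 + 1 by ring, Finset.sum_range_succ,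
      Finset.sum_range_succ, ih, Finset.sum_range_succ]
    ring

theorem exists_isCore_consecutive_card_eq (hm : 0 < m) :
    ∃ μ : YoungDiagram, μ.IsCore (2 * m + 1) ∧ μ.IsCore (2 * m + 2) ∧ μ.IsCore (2 * m + 3) ∧
      6 * (μ.card : ℤ) = m * (m + 1) ^ 2 * (m + 2) := by
  -- The least gap of residue r. It may grow by at most 2m + 2 over one residue and 2m + 3 over two;
  -- the increments of `f` alternate between 2m + 2 and 1.
  let f : ℕ → ℕ := fun r => (2 * m + 1) * ((r + 1) / 2) + r
  have hmono : Monotone f := fun r r' h =>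
    add_le_add (Nat.mul_le_mul_left _ (Nat.div_le_div_right (by omega))) h
  have hodd : ∀ j, f (2 * j + 1) = (2 * m + 1) * (j + 1) + (2 * j + 1) := fun j => by
    simp only [f]
    rw [show (2 * j + 1 + 1) / 2 = j + 1 by omega]
  have heven : ∀ j, f (2 * j + 2) = (2 * m + 1) * (j + 1) + (2 * j + 2) := fun j => by
    simp only [f]
    rw [show (2 * j + 2 + 1) / 2 = j + 1 by omega]
  have hstep2 : ∀ r, f (r + 2) = f r + (2 * m + 3) := fun r => by
    simp only [f]
    rw [show (r + 2 + 1) / 2 = (r + 1) / 2 + 1 by omega]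
    ring
  have hstep1 : ∀ r, f (r + 1) ≤ f r + (2 * m + 2) := fun r => by
    have h : (r + 1 + 1) / 2 ≤ (r + 1) / 2 + 1 := by omega
    have h' := Nat.mul_le_mul_left (2 * m + 1) h
    simp only [f]
    rw [mul_add] at h'
    omega
  obtain ⟨μ, hμ⟩ := exists_isApery_betaSet (a := 2 * m + 1) (v := fun z => f z.val)
    (fun z => by
      simp only [f]
      rw [Nat.cast_add, Nat.cast_mul, ZMod.natCast_self, zero_mul, zero_add, ZMod.natCast_val,
        ZMod.cast_id])
    (by simp [f])
  -- Wrapping around only lowers the residue, so for monotone `f` the increments of `f` itself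
  -- suffice.
  have hval : ∀ (z : ZMod (2 * m + 1)) (t n : ℕ), t = n + (2 * m + 1) →
      (z + (t : ZMod (2 * m + 1))).val ≤ z.val + n := by
    rintro z _ n rfl
    rw [Nat.cast_add, ZMod.natCast_self, add_zero]
    refine (ZMod.val_add_le _ _).trans ?_
    rw [ZMod.val_natCast]
    exact Nat.add_le_add_left (Nat.mod_le _ _) _
  refine ⟨μ, hμ.isCore_modulus, (hμ.isCore_iff (by omega)).2 fun z => ?_,
    (hμ.isCore_iff (by omega)).2 fun z => ?_, ?_⟩
  · exact (hmono (hval z _ 1 (by ring))).trans (hstep1 _)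
  · exact (hmono (hval z _ 2 (by ring))).trans (hstep2 _).le
  · have h := hμ.card_eq
    have hf0 : f 0 = 0 := by simp [f]
    have h1 : ∀ n : ℕ, ∑ r ∈ Finset.range (2 * n + 1), (f r : ℤ) =
        (2 * m + 3) * (n * (n + 1)) - n := by
      intro n
      rw [sum_range_two_mul_add_one]
      induction n with
      | zero => simp [hf0]
      | succ n ih =>
        rw [Finset.sum_range_succ, ← add_assoc, ih, hodd, heven]
        push_cast
        ring
    have h2 : ∀ n : ℕ, 3 * ∑ r ∈ Finset.range (2 * n + 1), (f r : ℤ) ^ 2 =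
        (2 * m + 3) ^ 2 * (n * (n + 1) * (2 * n + 1)) - 3 * (2 * m + 3) * (n * (n + 1)) +
          3 * n := by
      intro n
      rw [sum_range_two_mul_add_one (fun r => (f r : ℤ) ^ 2)]
      induction n with
      | zero => simp [hf0]
      | succ n ih =>
        rw [Finset.sum_range_succ, ← add_assoc, mul_add, ih, hodd, heven]
        push_cast
        ring
    have h1' := h1 m
    have h2' := h2 m
    rw [scaledVariance, ZMod.card, ZMod.sum_val (fun r => (f r : ℤ)),
      ZMod.sum_val (fun r => (f r : ℤ) ^ 2), h1'] at h
    push_cast at h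
    have ha : 4 * (2 * (m : ℤ) + 1) ^ 2 ≠ 0 := by positivity
    apply mul_left_cancel₀ ha
    linear_combination h + 4 * (2 * (m : ℤ) + 1) * h2'

end Consecutive

/-! ### Comparison of the two maxima -/

theorem proposition5p2 (s k : ℕ) (hs : s = 2 * k) (hs2 : 2 < s) :
    (∃! κ : YoungDiagram, κ.IsLargestSimultaneousCore {s - 1, s + 1}) ∧
    (∃ μ : YoungDiagram, μ.IsLargestSimultaneousCore {s - 1, s, s + 1}) ∧
    ∀ κ μ : YoungDiagram,
      κ.IsLargestSimultaneousCore {s - 1, s + 1} →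
      μ.IsLargestSimultaneousCore {s - 1, s, s + 1} →
      μ.card < κ.card ∧ κ.card = 4 * μ.card := by
  obtain ⟨m, rfl⟩ : ∃ m, k = m + 1 := ⟨k - 1, by omega⟩
  have hm : 0 < m := by omega
  obtain ⟨e1, e2, e3⟩ : s - 1 = 2 * m + 1 ∧ s = 2 * m + 2 ∧ s + 1 = 2 * m + 3 := by omega
  rw [e1, e3, e2]
  have hco := coprime_two_mul_add m
  obtain ⟨κ₀, ha, hb, hκ₀⟩ := exists_isCore_card_eq hco (by omega)
  obtain ⟨μ₀, h₁, h₂, h₃, hμ₀⟩ := exists_isCore_consecutive_card_eq hm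
  have hκ : ∀ κ : YoungDiagram, κ.IsLargestSimultaneousCore {2 * m + 1, 2 * m + 3} ↔
      (κ.IsCore (2 * m + 1) ∧ κ.IsCore (2 * m + 3)) ∧ κ.card = κ₀.card := by
    intro κ
    simp only [IsLargestSimultaneousCore, isSimultaneousCore_pair]
    have hle : ∀ ν : YoungDiagram, ν.IsCore (2 * m + 1) ∧ ν.IsCore (2 * m + 3) →
        ν.card ≤ κ₀.card := by
      rintro ν ⟨hνa, hνb⟩
      have := card_le_of_isCore hco (by omega) hνa hνb
      omega
    exact ⟨fun h => ⟨h.1, le_antisymm (hle κ h.1) (h.2 κ₀ ⟨ha, hb⟩)⟩,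
      fun h => ⟨h.1, fun ν hν => h.2 ▸ hle ν hν⟩⟩
  have hμ : ∀ μ : YoungDiagram,
      μ.IsLargestSimultaneousCore {2 * m + 1, 2 * m + 2, 2 * m + 3} ↔
      (μ.IsCore (2 * m + 1) ∧ μ.IsCore (2 * m + 2) ∧ μ.IsCore (2 * m + 3)) ∧
        μ.card = μ₀.card := by
    intro μ
    simp only [IsLargestSimultaneousCore, isSimultaneousCore_triple]
    have hle : ∀ ν : YoungDiagram,
        ν.IsCore (2 * m + 1) ∧ ν.IsCore (2 * m + 2) ∧ ν.IsCore (2 * m + 3) →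
        ν.card ≤ μ₀.card := by
      rintro ν ⟨hν₁, hν₂, hν₃⟩
      have := card_le_of_isCore_consecutive hν₁ hν₂ hν₃
      omega
    exact ⟨fun h => ⟨h.1, le_antisymm (hle μ h.1) (h.2 μ₀ ⟨h₁, h₂, h₃⟩)⟩,
      fun h => ⟨h.1, fun ν hν => h.2 ▸ hle ν hν⟩⟩
  refine ⟨⟨κ₀, (hκ κ₀).2 ⟨⟨ha, hb⟩, rfl⟩, fun κ h => ?_⟩, ⟨μ₀, (hμ μ₀).2 ⟨⟨h₁, h₂, h₃⟩, rfl⟩⟩,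
    fun κ μ hκ' hμ' => ?_⟩
  · obtain ⟨⟨hκa, hκb⟩, hcard⟩ := (hκ κ).1 h
    exact eq_of_card_eq hco (by omega) hκa hκb ha hb (hcard ▸ hκ₀) hκ₀
  · rw [((hκ κ).1 hκ').2, ((hμ μ).1 hμ').2]
    -- For a = 2m + 1 and b = 2m + 3, (a² - 1)(b² - 1) = 16 m(m + 1)²(m + 2), and 16/24 = 4/6.
    have h4 : (κ₀.card : ℤ) = 4 * μ₀.card := by
      push_cast at hκ₀
      have : 24 * (κ₀.card : ℤ) = 24 * (4 * μ₀.card) := by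
        linear_combination hκ₀ - 16 * hμ₀
      linarith
    have hpos : 0 < 6 * (μ₀.card : ℤ) := by
      rw [hμ₀]
      positivity
    omega
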